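/- Let $S:\mathbb{R}^N\rightrightarrows\mathbb{R}^N$ be a set-valued mapping with graph $\operatorname{gph}S=\{(x,v): v\in S(x)\}$, let $\bar v\in S(\bar x)$, and suppose that $S$ is maximal monotone locally at $\bar x$ for $\bar v$: there are neighborhoods $\mathcal X$ of $\bar x$ and $\mathcal V$ of $\bar v$ such that $(x_1-x_0)\cdot(v_1-v_0)\ge 0$ for all $(x_0,v_0),(x_1,v_1)\in[\mathcal X\times\mathcal V]\cap\operatorname{gph}S$, and no mapping $S'$ with this same property on $\mathcal X\times\mathcal V$ has $[\mathcal X\times\mathcal V]\cap\operatorname{gph}S'$ properly containing $[\mathcal X\times\mathcal V]\cap\operatorname{gph}S$. Then: 1. $S$ has the Aubin property at $\bar x$ for $\bar v$ if and only if $S$ has a single-valued Lipschitz continuous localization at $\bar x$ for $\bar v$. 2. $S$ has the Aubin property at $\bar x$ for $\bar v$ if and only if the Mordukhovich criterion $D^*S(\bar x|\bar v)(0)=\{0\}$ holds, and this criterion is equivalent to the strict graphical derivative condition $D_*S(\bar x|\bar v)(0)=\{0\}$. Here the Aubin property means that there are neighborhoods $\mathcal X$ of $\bar x$, $\mathcal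 V$ of $\bar v$ and a constant $\kappa\ge 0$ such that $S(x)\neq\emptyset$ for $x\in\mathcal X$ and, for every $v\in\mathcal V$, the function $x\mapsto\operatorname{dist}(S(x),v)$ is Lipschitz continuous on $\mathcal X$ with constant $\kappa$. A single-valued Lipschitz continuous localization is a Lipschitz continuous function $s:\mathcal X\to\mathcal V$ with $s(\bar x)=\bar v$ and $\operatorname{gph}s=[\mathcal X\times\mathcal V]\cap\operatorname{gph}S$ for some neighborhood $\mathcal X\times\mathcal V$ of $(\bar x,\bar v)$. The strict graphical derivative is given by: $v'\in D_*S(\bar x|\bar v)(x')$ if and only if there are $(x_k,v_k)\to(\bar x,\bar v)$ in $\operatorname{gph}S$, $t_k\downarrow 0$ and $(x_k',v_k')\to(x',v')$ with $(x_k+t_kx_k',\,v_k+t_kv_k')\in\operatorname{gph}S$ for all $k$. The coderivative is given by: $v'\in D^*S(\bar x|\bar v)(x')$ if and only if $(v',-x')\in N_{\operatorname{gph}S}(\bar x,\bar v)$, where $N_C(z)$ is the limiting normal cone, i.e. the set of limits of sequences $n_k$ such that, for some $z_k\to z$ in $C$, $n_k\cdot(y-z_k)\le o(|y-z_k|)$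 for $y\to z_k$ in $C$. -/

import Mathlib

open Filter Topology
open scoped NNReal

namespace VarAnalysis

/-! Set-valued mappings `S : E ⇉ F` are functions `S : E → Set F`; empty values are allowed. -/

section Cones

/-- The graph `{(x, v) | v ∈ S x}` of a set-valued mapping. -/
def gph {E F : Type*} (S : E → Set F) : Set (E × F) :=
  {z | z.2 ∈ S z.1}

/-- The paratingent cone to `C` at `z`: all limits `w` of vectors `w k` such that
`z k ∈ C` and `z k + t k • w k ∈ C`, where `z k → z` and `t k ↓ 0`. -/
def paratingentCone {H : Type*} [NormedAddCommGroup H] [NormedSpace ℝ H]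
    (C : Set H) (z : H) : Set H :=
  {w | ∃ (zs : ℕ → H) (ts : ℕ → ℝ) (ws : ℕ → H),
    (∀ k, zs k ∈ C) ∧ (∀ k, 0 < ts k) ∧ (∀ k, zs k + ts k • ws k ∈ C) ∧
    Tendsto zs atTop (𝓝 z) ∧ Tendsto ts atTop (𝓝 0) ∧ Tendsto ws atTop (𝓝 w)}

/-- The regular normal cone to `C` at `z ∈ C`: all `n` with
`⟪n, y - z⟫ ≤ o(‖y - z‖)` for `y ∈ C`, `y → z` (empty if `z ∉ C`). -/
def regularNormalCone {H : Type*} [NormedAddCommGroup H] [InnerProductSpace ℝ H]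
    (C : Set H) (z : H) : Set H :=
  {n | z ∈ C ∧ ∀ ε : ℝ, 0 < ε → ∀ᶠ y in 𝓝[C] z, inner ℝ n (y - z) ≤ ε * ‖y - z‖}

/-- The normal cone of variational analysis (general, or limiting, normal cone) to `C` at `z`:
limits of regular normals to `C` at points of `C` converging to `z`. -/
def normalCone {H : Type*} [NormedAddCommGroup H] [InnerProductSpace ℝ H]
    (C : Set H) (z : H) : Set H :=
  {n | ∃ (zs : ℕ → H) (ns : ℕ → H),
    (∀ k, zs k ∈ C) ∧ (∀ k, ns k ∈ regularNormalCone C (zs k)) ∧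
    Tendsto zs atTop (𝓝 z) ∧ Tendsto ns atTop (𝓝 n)}

end Cones

section Derivatives

/-- The strict graphical derivative `D_* S(x | v)`: its graph is the paratingent cone to the
graph of `S` at `(x, v)`. -/
def strictGraphicalDerivative {E F : Type*} [NormedAddCommGroup E] [NormedSpace ℝ E]
    [NormedAddCommGroup F] [NormedSpace ℝ F] (S : E → Set F) (x : E) (v : F) : E → Set F :=
  fun x' => {v' | (x', v') ∈ paratingentCone (gph S) (x, v)}

/-- The coderivative `D^* S(x | v)`: `v' ∈ D^* S(x | v)(x')` iff `(v', -x')` is normal to the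
graph of `S` at `(x, v)`. The product space carries the Euclidean inner product
`⟪(a, b), (c, d)⟫ = ⟪a, c⟫ + ⟪b, d⟫`, that is, it is `WithLp 2 (E × F)`. -/
def coderivative {E F : Type*} [NormedAddCommGroup E] [InnerProductSpace ℝ E]
    [NormedAddCommGroup F] [InnerProductSpace ℝ F] (S : E → Set F) (x : E) (v : F) :
    F → Set E :=
  fun x' => {v' | WithLp.toLp 2 (v', -x') ∈
    normalCone (WithLp.ofLp ⁻¹' gph S : Set (WithLp 2 (E × F))) (WithLp.toLp 2 (x, v))}

end Derivatives

section Localizations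

/-- The Aubin property of `S` at `x` for `v ∈ S x`: on some neighborhood `X` of `x` the distance
`dist(S x₁, v₁)` is a (finite) function of `x₁ ∈ X` that is Lipschitz continuous, with one
constant for all `v₁` in a neighborhood `V` of `v`. Finiteness of the distance is the
nonemptiness of `S x₁`. -/
def HasAubinProperty {E F : Type*} [NormedAddCommGroup E] [NormedAddCommGroup F]
    (S : E → Set F) (x : E) (v : F) : Prop :=
  v ∈ S x ∧ ∃ X ∈ 𝓝 x, ∃ V ∈ 𝓝 v, ∃ κ : ℝ≥0,
    (∀ x₁ ∈ X, (S x₁).Nonempty) ∧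
    ∀ v₁ ∈ V, LipschitzOnWith κ (fun x₁ => Metric.infDist v₁ (S x₁)) X

/-- `S` has a single-valued localization `s : X → V` at `x` for `v`, with `s x = v` and
`gph s = [X × V] ∩ gph S` for a neighborhood `X × V` of `(x, v)`, that is Lipschitz continuous.
(Only the values of `s` on `X` matter.) -/
def HasLipschitzLocalization {E F : Type*} [NormedAddCommGroup E] [NormedAddCommGroup F]
    (S : E → Set F) (x : E) (v : F) : Prop :=
  ∃ X ∈ 𝓝 x, ∃ V ∈ 𝓝 v, ∃ s : E → F,
    s x = v ∧ {z : E × F | z.1 ∈ X ∧ z.2 = s z.1} = (X ×ˢ V) ∩ gph S ∧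
    ∃ κ : ℝ≥0, LipschitzOnWith κ s X

end Localizations

section Monotonicity

/-- `S` is monotone relative to `X × V`. -/
def MonotoneRelTo {E : Type*} [NormedAddCommGroup E] [InnerProductSpace ℝ E]
    (S : E → Set E) (X V : Set E) : Prop :=
  ∀ z₀ ∈ (X ×ˢ V) ∩ gph S, ∀ z₁ ∈ (X ×ˢ V) ∩ gph S, 0 ≤ inner ℝ (z₁.1 - z₀.1) (z₁.2 - z₀.2)

/-- `S` is maximal monotone locally at `x` for `v ∈ S x`: on some neighborhood `X × V` of
`(x, v)` it is monotone, and no mapping `S'` monotone relative to `X × V` has a graph whose part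
in `X × V` properly contains that of `S`. -/
def LocallyMaximalMonotone {E : Type*} [NormedAddCommGroup E] [InnerProductSpace ℝ E]
    (S : E → Set E) (x v : E) : Prop :=
  v ∈ S x ∧ ∃ X ∈ 𝓝 x, ∃ V ∈ 𝓝 v, MonotoneRelTo S X V ∧
    ¬ ∃ S' : E → Set E, MonotoneRelTo S' X V ∧ (X ×ˢ V) ∩ gph S ⊂ (X ×ˢ V) ∩ gph S'

end Monotonicity

end VarAnalysis

/-! Everything is compared with the Lipschitz localization. Such a localization yields the Aubin
property and, by estimates on difference quotients and normals, both derivative criteria.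
Conversely, the Aubin property gives `LipschitzLike`: graph points can follow their argument at
linear cost. Monotonicity then excludes two nearby values at one point, since the argument could be
moved towards one value while following the other (`LipschitzLike.exists_unique_near`). Each
criterion gives `HalvingProperty`, which suffices because the graph is locally compact. For the
coderivative, a halved point minimizes a weighted squared distance and optimality provides a regular
normal. For the strict derivative it is a resolvent point, produced by Minty's theorem and placed on
the graph by maximality. -/

namespace VarAnalysis

/-! ### Minty's theorem for monotone sets in finite dimension, via a minimax argument. -/

section Minty

variable {E : Type*} [NormedAddCommGroup E] [InnerProductSpace ℝ E]

/-- The right side minus the left is half the weighted double sum of the nonnegative numbers `inner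
ℝ (p i - p j) (q i - q j)`. -/
theorem inner_sum_le_sum_inner_of_monotone {ι : Type*} [Fintype ι] {p q : ι → E}
    (h : ∀ i j, 0 ≤ inner ℝ (p i - p j) (q i - q j)) {w : ι → ℝ} (hw : w ∈ stdSimplex ℝ ι) :
    inner ℝ (∑ i, w i • p i) (∑ i, w i • q i) ≤ ∑ i, w i * inner ℝ (p i) (q i) := by
  have h0 : 0 ≤ ∑ i, ∑ j, w i * (w j * inner ℝ (p i - p j) (q i - q j)) :=
    Finset.sum_nonneg fun i _ => Finset.sum_nonneg fun j _ =>
      mul_nonneg (hw.1 i) (mul_nonneg (hw.1 j) (h i j))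
  have e1 : ∑ i, ∑ j, w i * (w j * inner ℝ (p i) (q i)) = ∑ i, w i * inner ℝ (p i) (q i) := by
    refine Finset.sum_congr rfl fun i _ => ?_
    rw [← Finset.mul_sum, ← Finset.sum_mul, hw.2, one_mul]
  have e2 : ∑ i, ∑ j, w i * (w j * inner ℝ (p j) (q j)) = ∑ i, w i * inner ℝ (p i) (q i) := by
    rw [← Finset.sum_mul_sum, hw.2, one_mul]
  have e3 : ∑ i, ∑ j, w i * (w j * inner ℝ (p i) (q j)) =
      inner ℝ (∑ i, w i • p i) (∑ i, w i • q i) := by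
    rw [sum_inner]
    refine Finset.sum_congr rfl fun i _ => ?_
    rw [inner_smul_left, inner_sum, RCLike.conj_to_real, Finset.mul_sum]
    simp only [inner_smul_right]
  have e4 : ∑ i, ∑ j, w i * (w j * inner ℝ (p j) (q i)) =
      inner ℝ (∑ i, w i • p i) (∑ i, w i • q i) := by
    rw [← e3, Finset.sum_comm]
    refine Finset.sum_congr rfl fun i _ => Finset.sum_congr rfl fun j _ => ?_
    ring
  have e5 : ∑ i, ∑ j, w i * (w j * inner ℝ (p i - p j) (q i - q j)) =
      ∑ i, ∑ j, w i * (w j * inner ℝ (p i) (q i)) + ∑ i, ∑ j, w i * (w j * inner ℝ (p j) (q j))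
      - ∑ i, ∑ j, w i * (w j * inner ℝ (p i) (q j))
      - ∑ i, ∑ j, w i * (w j * inner ℝ (p j) (q i)) := by
    simp only [← Finset.sum_add_distrib, ← Finset.sum_sub_distrib]
    refine Finset.sum_congr rfl fun i _ => Finset.sum_congr rfl fun j _ => ?_
    simp only [inner_sub_left, inner_sub_right]
    ring
  linarith

theorem convexOn_sum_inner_sub_sub {ι : Type*} [Fintype ι] (p q : ι → E) {w : ι → ℝ}
    (hw : ∀ i, 0 ≤ w i) {X : Set E} (hX : Convex ℝ X) :
    ConvexOn ℝ X fun x => ∑ i, w i * inner ℝ (x - p i) (x - q i) := by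
  refine ⟨hX, fun x _ y _ a b ha hb hab => ?_⟩
  simp only [smul_eq_mul, Finset.mul_sum, ← Finset.sum_add_distrib]
  refine Finset.sum_le_sum fun i _ => ?_
  obtain rfl : b = 1 - a := by linarith
  have key : a * inner ℝ (x - p i) (x - q i) + (1 - a) * inner ℝ (y - p i) (y - q i)
      - inner ℝ (a • x + (1 - a) • y - p i) (a • x + (1 - a) • y - q i)
      = a * (1 - a) * inner ℝ (x - y) (x - y) := by
    simp only [inner_sub_left, inner_sub_right, inner_add_left, inner_add_right,
      inner_smul_left, inner_smul_right, real_inner_comm x y, RCLike.conj_to_real]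
    ring
  have h1 : 0 ≤ a * (1 - a) * inner ℝ (x - y) (x - y) :=
    mul_nonneg (mul_nonneg ha hb) real_inner_self_nonneg
  nlinarith [hw i, mul_nonneg (hw i) h1]

/-- Finitely many monotone pairs admit a monotonically related pair with prescribed sum. -/
theorem exists_forall_inner_nonneg_of_fintype {ι : Type*} [Fintype ι] [Nonempty ι] {p q : ι → E}
    (h : ∀ i j, 0 ≤ inner ℝ (p i - p j) (q i - q j)) (z : E) :
    ∃ x : E, ∀ i, 0 ≤ inner ℝ (x - p i) (z - x - q i) := by
  classical
  -- `c i` is the midpoint of `p i` and `z - q i`, the minimizer of `x ↦ inner ℝ (x - p i) (x - (z -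
  -- q i))`.
  set c : ι → E := fun i => (1 / 2 : ℝ) • (z + p i - q i) with hc
  set X : Set E := convexHull ℝ (Set.range c) with hXdef
  have hXc : Convex ℝ X := convex_convexHull ℝ _
  have hXk : IsCompact X := (Set.finite_range c).isCompact_convexHull ℝ
  have hXn : X.Nonempty := (Set.range_nonempty c).convexHull
  have hYn : (stdSimplex ℝ ι).Nonempty := ⟨_, single_mem_stdSimplex ℝ (Classical.arbitrary ι)⟩
  -- The goal is an `x` with `f x w ≤ 0` at every vertex `w` of the simplex; a saddle point provides
  -- it.
  let f : E → (ι → ℝ) → ℝ := fun x w => ∑ i, w i * inner ℝ (x - p i) (x - (z - q i))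
  have hf : ∀ x, ConcaveOn ℝ (stdSimplex ℝ ι) (f x) := fun x => by
    refine ⟨convex_stdSimplex ℝ ι, fun u _ v _ a b _ _ _ => le_of_eq ?_⟩
    simp only [f, smul_eq_mul, Finset.mul_sum, ← Finset.sum_add_distrib, Pi.add_apply,
      Pi.smul_apply]
    exact Finset.sum_congr rfl fun i _ => by ring
  obtain ⟨a, -, b, hb, hab⟩ := Sion.exists_isSaddlePointOn (f := f) hXn hXc hXk
    (fun w _ => (Continuous.lowerSemicontinuous (by fun_prop)).lowerSemicontinuousOn _)
    (fun w hw => (convexOn_sum_inner_sub_sub p (fun i => z - q i) hw.1 hXc).quasiconvexOn)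
    (convex_stdSimplex ℝ ι) hYn (isCompact_stdSimplex ℝ ι)
    (fun x _ => (Continuous.upperSemicontinuous (by fun_prop)).upperSemicontinuousOn _)
    (fun x _ => (hf x).quasiconcaveOn)
  set P := ∑ i, b i • p i with hP
  set Q := ∑ i, b i • q i with hQ
  -- This is the minimizer of `f · b`, the `b`-average of the points `c i`.
  have hxb : (1 / 2 : ℝ) • (z + P - Q) ∈ X := by
    have : (1 / 2 : ℝ) • (z + P - Q) = ∑ i, b i • c i := by
      simp only [hc, smul_comm _ (1 / 2 : ℝ), ← Finset.smul_sum, smul_sub, smul_add,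
        Finset.sum_sub_distrib, Finset.sum_add_distrib, ← Finset.sum_smul, hb.2, one_smul, hP, hQ]
    rw [this]
    exact hXc.sum_mem (fun i _ => hb.1 i) hb.2
      fun i _ => subset_convexHull ℝ _ (Set.mem_range_self i)
  refine ⟨a, fun i => ?_⟩
  have h1 := hab _ hxb _ (single_mem_stdSimplex ℝ i)
  have h2 : f a (Pi.single i 1) = inner ℝ (a - p i) (a - (z - q i)) := by
    simp [f, Pi.single_apply]
  have h3 : ∀ x, f x b = inner ℝ (x - P) (x - z + Q) + inner ℝ P Q
      - ∑ i, b i * inner ℝ (p i) (q i) := fun x => by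
    have e : ∀ i, b i * inner ℝ (x - p i) (x - (z - q i)) =
        b i * inner ℝ x (x - z) + inner ℝ x (b i • q i) - inner ℝ (b i • p i) (x - z)
          - b i * inner ℝ (p i) (q i) := fun i => by
      simp only [inner_sub_left, inner_sub_right, inner_smul_left, inner_smul_right,
        RCLike.conj_to_real]
      ring
    simp only [f, e, Finset.sum_sub_distrib, Finset.sum_add_distrib, ← Finset.sum_mul, hb.2,
      ← inner_sum, ← sum_inner, one_mul]
    rw [← hP, ← hQ]
    simp only [inner_sub_left, inner_sub_right, inner_add_right]
    ring
  -- The value is `-‖z - P - Q‖² / 4` plus a term that monotonicity makes nonpositive.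
  have h4 : f ((1 / 2 : ℝ) • (z + P - Q)) b ≤ 0 := by
    rw [h3]
    have e1 : (1 / 2 : ℝ) • (z + P - Q) - P = (1 / 2 : ℝ) • (z - P - Q) := by module
    have e2 : (1 / 2 : ℝ) • (z + P - Q) - z + Q = (-(1 / 2) : ℝ) • (z - P - Q) := by module
    rw [e1, e2, inner_smul_left, inner_smul_right]
    have := inner_sum_le_sum_inner_of_monotone h hb
    have h5 : 0 ≤ inner ℝ (z - P - Q) (z - P - Q) := real_inner_self_nonneg
    rw [← hP, ← hQ] at this
    simp only [RCLike.conj_to_real]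
    nlinarith
  have h6 : inner ℝ (a - p i) (z - a - q i) = - inner ℝ (a - p i) (a - (z - q i)) := by
    rw [← inner_neg_right]; congr 1; abel
  rw [h6]
  linarith

/-- A monotone set of pairs admits a monotonically related pair with prescribed sum. -/
theorem exists_forall_inner_nonneg [FiniteDimensional ℝ E] {G : Set (E × E)}
    (h : ∀ p ∈ G, ∀ q ∈ G, 0 ≤ inner ℝ (q.1 - p.1) (q.2 - p.2)) (z : E) :
    ∃ x : E, ∀ p ∈ G, 0 ≤ inner ℝ (x - p.1) (z - x - p.2) := by
  classical
  have : ProperSpace E := FiniteDimensional.proper ℝ E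
  rcases G.eq_empty_or_nonempty with rfl | ⟨p₀, hp₀⟩
  · exact ⟨0, by simp⟩
  let C : G → Set E := fun p => {x | 0 ≤ inner ℝ (x - p.1.1) (z - x - p.1.2)}
  have hC : ∀ p, IsClosed (C p) := fun p => isClosed_le continuous_const (by fun_prop)
  -- Membership gives `‖x - p₀.1‖² ≤ inner ℝ (x - p₀.1) (z - p₀.2 - p₀.1)`, so Cauchy–Schwarz bounds
  -- the set.
  have hK : IsCompact (C ⟨p₀, hp₀⟩) := by
    refine Metric.isCompact_of_isClosed_isBounded (hC _)
      ((Metric.isBounded_closedBall (x := p₀.1) (r := ‖z - p₀.2 - p₀.1‖)).subset fun x hx => ?_)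
    rw [mem_closedBall_iff_norm]
    have hx : 0 ≤ inner ℝ (x - p₀.1) (z - x - p₀.2) := hx
    have e : z - x - p₀.2 = (z - p₀.2 - p₀.1) - (x - p₀.1) := by abel
    rw [e, inner_sub_right, real_inner_self_eq_norm_sq] at hx
    have := real_inner_le_norm (x - p₀.1) (z - p₀.2 - p₀.1)
    by_contra! hlt
    nlinarith [norm_nonneg (z - p₀.2 - p₀.1)]
  obtain ⟨x, -, hx⟩ := hK.inter_iInter_nonempty C hC fun u => by
    let u' := insert ⟨p₀, hp₀⟩ u
    have : Nonempty u' := ⟨⟨⟨p₀, hp₀⟩, Finset.mem_insert_self _ _⟩⟩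
    obtain ⟨x, hx⟩ := exists_forall_inner_nonneg_of_fintype (ι := u')
      (p := fun i => i.1.1.1) (q := fun i => i.1.1.2) (fun i j => h _ j.1.2 _ i.1.2) z
    refine ⟨x, hx ⟨_, Finset.mem_insert_self _ _⟩, ?_⟩
    simp only [Set.mem_iInter]
    exact fun i hi => hx ⟨i, Finset.mem_insert_of_mem hi⟩
  exact ⟨x, fun p hp => Set.mem_iInter.1 hx ⟨p, hp⟩⟩

theorem exists_add_smul_eq_forall_inner_nonneg [FiniteDimensional ℝ E] {G : Set (E × E)}
    (h : ∀ p ∈ G, ∀ q ∈ G, 0 ≤ inner ℝ (q.1 - p.1) (q.2 - p.2)) {c : ℝ} (hc : 0 < c) (z : E) :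
    ∃ q : E × E, q.1 + c • q.2 = z ∧ ∀ p ∈ G, 0 ≤ inner ℝ (q.1 - p.1) (q.2 - p.2) := by
  obtain ⟨x, hx⟩ := exists_forall_inner_nonneg (G := (fun p : E × E => (p.1, c • p.2)) '' G)
    (by
      rintro _ ⟨p, hp, rfl⟩ _ ⟨q, hq, rfl⟩
      simp only [← smul_sub, inner_smul_right]
      exact mul_nonneg hc.le (h p hp q hq)) z
  refine ⟨(x, c⁻¹ • (z - x)), by simp [smul_smul, hc.ne'], fun p hp => ?_⟩
  have := hx _ ⟨p, hp, rfl⟩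
  have e : z - x - c • p.2 = c • (c⁻¹ • (z - x) - p.2) := by
    rw [smul_sub, smul_smul, mul_inv_cancel₀ hc.ne', one_smul]
  simp only [e, inner_smul_right] at this
  exact nonneg_of_mul_nonneg_right this hc

end Minty

/-! ### Metric forms of the Aubin property, without monotonicity. -/

section LipschitzLike

variable {E F : Type*} [NormedAddCommGroup E] [NormedAddCommGroup F]

/-- The Lipschitz-like form of the Aubin property: graph points near `(x, v)` can be followed
linearly when the argument moves near `x`. -/
def LipschitzLike (S : E → Set F) (x : E) (v : F) : Prop :=
  ∃ ρ > 0, ∃ L > 0, ∀ p ∈ gph S ∩ Metric.closedBall (x, v) ρ, ∀ y ∈ Metric.closedBall x ρ,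
    ∃ w ∈ S y, ‖w - p.2‖ ≤ L * ‖y - p.1‖

/-- Graph points near `(x, v)` can be moved to halve the distance of the argument to a target,
at a linear cost. -/
def HalvingProperty (S : E → Set F) (x : E) (v : F) : Prop :=
  ∃ ρ > 0, ∃ M > 0, ∀ p ∈ gph S ∩ Metric.closedBall (x, v) ρ, ∀ y ∈ Metric.closedBall x ρ,
    ∃ q ∈ gph S, ‖q.1 - y‖ ≤ 1 / 2 * ‖p.1 - y‖ ∧ ‖q.2 - p.2‖ ≤ M * ‖p.1 - y‖

theorem mem_closedBall_prod_iff {x : E} {v : F} {p : E × F} {ρ : ℝ} :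
    p ∈ Metric.closedBall (x, v) ρ ↔ ‖p.1 - x‖ ≤ ρ ∧ ‖p.2 - v‖ ≤ ρ := by
  rw [mem_closedBall_iff_norm, Prod.norm_def, max_le_iff]
  rfl

theorem HasAubinProperty.lipschitzLike {S : E → Set F} {x : E} {v : F}
    (h : HasAubinProperty S x v) : LipschitzLike S x v := by
  obtain ⟨-, X, hX, V, hV, κ, hne, hlip⟩ := h
  obtain ⟨r, hr, hrX⟩ := Metric.nhds_basis_closedBall.mem_iff.1 hX
  obtain ⟨t, ht, htV⟩ := Metric.nhds_basis_closedBall.mem_iff.1 hV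
  -- The distance to `S y` need not be attained; the slack in `κ + 1` makes the bound strict when `y
  -- ≠ p.1`.
  refine ⟨min r t, lt_min hr ht, κ + 1, by positivity, fun p ⟨hp, hpB⟩ y hy => ?_⟩
  rw [mem_closedBall_prod_iff] at hpB
  have hp1 : p.1 ∈ X := hrX (mem_closedBall_iff_norm.2 (hpB.1.trans (min_le_left _ _)))
  have hp2 : p.2 ∈ V := htV (mem_closedBall_iff_norm.2 (hpB.2.trans (min_le_right _ _)))
  have hyX : y ∈ X := hrX (Metric.closedBall_subset_closedBall (min_le_left _ _) hy)
  rcases eq_or_ne y p.1 with rfl | hyp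
  · exact ⟨p.2, hp, by simp⟩
  have h1 := (hlip p.2 hp2).dist_le_mul y hyX p.1 hp1
  have h0 : Metric.infDist p.2 (S p.1) = 0 := Metric.infDist_zero_of_mem hp
  simp only [h0, sub_zero, dist_eq_norm] at h1
  have hpos : 0 < ‖y - p.1‖ := norm_pos_iff.2 (sub_ne_zero.2 hyp)
  have h2 : Metric.infDist p.2 (S y) < (κ + 1) * ‖y - p.1‖ := by
    have := Real.le_norm_self (Metric.infDist p.2 (S y))
    linarith
  obtain ⟨w, hw, hlt⟩ := (Metric.infDist_lt_iff (hne y hyX)).1 h2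
  refine ⟨w, hw, ?_⟩
  rw [dist_comm, dist_eq_norm] at hlt
  exact hlt.le

/-- An Ekeland-type argument: minimize `4 * M * ‖q.1 - y‖ + ‖q.2 - p.2‖` over a compact piece of the
graph. Away from `y`, halving saves `2 * M * ‖q.1 - y‖` and costs at most half of that, so the
minimizer lies over `y`. -/
theorem HalvingProperty.lipschitzLike {S : E → Set F} {x : E} {v : F} {ρ₀ : ℝ} (hρ₀ : 0 < ρ₀)
    (hK : ∀ ρ ≤ ρ₀, IsCompact (gph S ∩ Metric.closedBall (x, v) ρ))
    (h : HalvingProperty S x v) : LipschitzLike S x v := by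
  obtain ⟨ρ₁, hρ₁, M, hM, h⟩ := h
  set ρ := min ρ₀ ρ₁ with hρdef
  have hρ : 0 < ρ := lt_min hρ₀ hρ₁
  -- The second coordinate drifts by at most `8 * M * δ` to the minimizer and `2 * M * δ` in the
  -- halving step, so both points stay in the ball.
  set δ := ρ / (10 * M + 3) with hδdef
  have hδ : 0 < δ := by positivity
  have hδρ : δ * (10 * M + 3) = ρ := by rw [hδdef]; field_simp
  have hδM : 0 < δ * M := mul_pos hδ hM
  refine ⟨δ, hδ, 4 * M, by positivity, fun p ⟨hp, hpB⟩ y hy => ?_⟩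
  rw [mem_closedBall_prod_iff] at hpB
  rw [mem_closedBall_iff_norm] at hy
  have hpy : ‖p.1 - y‖ ≤ 2 * δ := by
    have := norm_sub_le_norm_sub_add_norm_sub p.1 x y
    rw [norm_sub_rev x y] at this
    linarith [hpB.1]
  have hpK : p ∈ gph S ∩ Metric.closedBall (x, v) ρ :=
    ⟨hp, mem_closedBall_prod_iff.2 ⟨by linarith [hpB.1], by linarith [hpB.2]⟩⟩
  obtain ⟨q, ⟨hq, hqB⟩, hmin⟩ := (hK ρ (min_le_left _ _)).exists_isMinOn ⟨p, hpK⟩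
    (f := fun q => 4 * M * ‖q.1 - y‖ + ‖q.2 - p.2‖) (by fun_prop)
  have hqp : 4 * M * ‖q.1 - y‖ + ‖q.2 - p.2‖ ≤ 4 * M * ‖p.1 - y‖ := by
    simpa using hmin hpK
  have hq1 : ‖q.1 - y‖ ≤ 2 * δ := by
    have : 4 * M * ‖q.1 - y‖ ≤ 4 * M * ‖p.1 - y‖ := by linarith [norm_nonneg (q.2 - p.2)]
    exact (le_of_mul_le_mul_left this (by positivity)).trans hpy
  have hq2 : ‖q.2 - p.2‖ ≤ 8 * (δ * M) := by
    have h1 : 0 ≤ 4 * M * ‖q.1 - y‖ := by positivity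
    have h2 : 4 * M * ‖p.1 - y‖ ≤ 4 * M * (2 * δ) := by gcongr
    linarith
  by_cases hqy : q.1 = y
  · refine ⟨q.2, hqy ▸ hq, ?_⟩
    rw [norm_sub_rev y]
    rw [hqy, sub_self, norm_zero, mul_zero, zero_add] at hqp
    exact hqp
  exfalso
  have hpos : 0 < ‖q.1 - y‖ := norm_pos_iff.2 (sub_ne_zero.2 hqy)
  obtain ⟨u, hu, hu1, hu2⟩ := h q
    ⟨hq, Metric.closedBall_subset_closedBall (min_le_right _ _) hqB⟩ y
    (mem_closedBall_iff_norm.2 (by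
      have : ρ ≤ ρ₁ := min_le_right _ _
      linarith))
  have hMq : M * ‖q.1 - y‖ ≤ M * (2 * δ) := by gcongr
  have huB : u ∈ Metric.closedBall (x, v) ρ := by
    refine mem_closedBall_prod_iff.2 ⟨?_, ?_⟩
    · have := norm_sub_le_norm_sub_add_norm_sub u.1 y x
      linarith
    · have h1 := norm_sub_le_norm_sub_add_norm_sub u.2 q.2 v
      have h2 := norm_sub_le_norm_sub_add_norm_sub q.2 p.2 v
      linarith [hpB.2]
  have h1 : 4 * M * ‖q.1 - y‖ + ‖q.2 - p.2‖ ≤ 4 * M * ‖u.1 - y‖ + ‖u.2 - p.2‖ := hmin ⟨hu, huB⟩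
  have h2 := norm_sub_le_norm_sub_add_norm_sub u.2 q.2 p.2
  have h3 : 4 * M * ‖u.1 - y‖ ≤ 4 * M * (1 / 2 * ‖q.1 - y‖) := by gcongr
  have h4 : 0 < M * ‖q.1 - y‖ := mul_pos hM hpos
  linarith

theorem HasLipschitzLocalization.hasAubinProperty {S : E → Set F} {x : E} {v : F}
    (h : HasLipschitzLocalization S x v) : HasAubinProperty S x v := by
  obtain ⟨X, hX, V, hV, s, hs, hgph, κ, hlip⟩ := h
  obtain ⟨r, hr, hrX⟩ := Metric.nhds_basis_closedBall.mem_iff.1 hX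
  obtain ⟨t, ht, htV⟩ := Metric.nhds_basis_closedBall.mem_iff.1 hV
  have hmem : ∀ y ∈ X, s y ∈ S y := fun y hy =>
    ((Set.ext_iff.1 hgph (y, s y)).1 ⟨hy, rfl⟩).2
  have hxX : x ∈ X := mem_of_mem_nhds hX
  refine ⟨hs ▸ hmem x hxX, ?_⟩
  -- Values of `S y` outside `V` are farther than `t - δ ≥ (κ + 1) * δ` from `w`, while `s y` is
  -- within `(κ + 1) * δ`; so `s y` realizes the distance.
  set δ := min r (t / (κ + 2)) with hδdef
  have hδ : 0 < δ := lt_min hr (by positivity)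
  have hδt : δ * (κ + 2) ≤ t := (le_div_iff₀ (by positivity)).1 (min_le_right _ _)
  have hBX : Metric.closedBall x δ ⊆ X :=
    (Metric.closedBall_subset_closedBall (min_le_left _ _)).trans hrX
  refine ⟨_, Metric.closedBall_mem_nhds x hδ, _, Metric.closedBall_mem_nhds v hδ, κ,
    fun y hy => ⟨s y, hmem y (hBX hy)⟩, fun w hw => ?_⟩
  have key : ∀ y ∈ Metric.closedBall x δ, Metric.infDist w (S y) = dist w (s y) := fun y hy => by
    have hyX := hBX hy
    refine le_antisymm (Metric.infDist_le_dist_of_mem (hmem y hyX))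
      ((Metric.le_infDist ⟨_, hmem y hyX⟩).2 fun {u} hu => ?_)
    by_cases huV : u ∈ V
    · have := ((Set.ext_iff.1 hgph (y, u)).2 ⟨⟨hyX, huV⟩, hu⟩).2
      exact le_of_eq (by rw [show u = s y from this])
    · have h1 : t < dist u v := by
        by_contra! hle
        exact huV (htV hle)
      have h2 := hlip.dist_le_mul y hyX x hxX
      rw [hs] at h2
      have h3 : (κ : ℝ) * dist y x ≤ κ * δ := by gcongr; exact hy
      have h4 := dist_triangle w v (s y)
      have h5 := dist_triangle u w v
      rw [dist_comm u w] at h5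
      rw [dist_comm v] at h4
      have h6 : dist w v ≤ δ := hw
      linarith
  refine LipschitzOnWith.of_dist_le_mul fun y hy z hz => ?_
  rw [key y hy, key z hz]
  refine (dist_dist_dist_le_right w (s y) (s z)).trans ?_
  exact hlip.dist_le_mul y (hBX hy) z (hBX hz)

theorem HasLipschitzLocalization.exists_norm_sub_le {S : E → Set F} {x : E} {v : F}
    (h : HasLipschitzLocalization S x v) :
    ∃ κ : ℝ≥0, ∃ U ∈ 𝓝 (x, v), ∀ p ∈ gph S ∩ U, ∀ q ∈ gph S ∩ U,
      ‖q.2 - p.2‖ ≤ κ * ‖q.1 - p.1‖ := by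
  obtain ⟨X, hX, V, hV, s, -, hgph, κ, hlip⟩ := h
  refine ⟨κ, X ×ˢ V, prod_mem_nhds hX hV, fun p hp q hq => ?_⟩
  have hp' : p.2 = s p.1 := ((Set.ext_iff.1 hgph p).2 ⟨hp.2, hp.1⟩).2
  have hq' : q.2 = s q.1 := ((Set.ext_iff.1 hgph q).2 ⟨hq.2, hq.1⟩).2
  rw [hp', hq', ← dist_eq_norm, ← dist_eq_norm]
  exact hlip.dist_le_mul _ hq.2.1 _ hp.2.1

theorem norm_toLp_le_add (a : E) (b : F) : ‖WithLp.toLp 2 (a, b)‖ ≤ ‖a‖ + ‖b‖ := by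
  refine abs_le_of_sq_le_sq' ?_ (by positivity) |>.2
  rw [WithLp.prod_norm_sq_eq_of_L2]
  simp only [WithLp.toLp_fst, WithLp.toLp_snd]
  nlinarith [norm_nonneg a, norm_nonneg b, mul_nonneg (norm_nonneg a) (norm_nonneg b)]

end LipschitzLike

/-! ### Consequences of local maximal monotonicity. -/

section Monotone

variable {E : Type*} [NormedAddCommGroup E] [InnerProductSpace ℝ E]

/-- A point of the ball monotonically related to the graph piece `G` could be added to it, so
maximality forces it into `G`. -/
theorem LocallyMaximalMonotone.exists_graph_piece {S : E → Set E} {x v : E}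
    (h : LocallyMaximalMonotone S x v) :
    ∃ ρ > 0, ∃ G ⊆ gph S, gph S ∩ Metric.closedBall (x, v) ρ ⊆ G ∧
      (∀ p ∈ G, ∀ q ∈ G, 0 ≤ inner ℝ (q.1 - p.1) (q.2 - p.2)) ∧
      ∀ q ∈ Metric.closedBall (x, v) ρ,
        (∀ p ∈ G, 0 ≤ inner ℝ (q.1 - p.1) (q.2 - p.2)) → q ∈ G := by
  obtain ⟨-, X, hX, V, hV, hmono, hmax⟩ := h
  obtain ⟨ρ, hρ, hB⟩ := Metric.nhds_basis_closedBall.mem_iff.1 (prod_mem_nhds hX hV)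
  refine ⟨ρ, hρ, (X ×ˢ V) ∩ gph S, Set.inter_subset_right, fun p hp => ⟨hB hp.2, hp.1⟩, hmono,
    fun q hq hrel => ?_⟩
  by_contra hqG
  have hgph : (X ×ˢ V) ∩ gph (fun y => {w | (y, w) ∈ insert q ((X ×ˢ V) ∩ gph S)}) =
      insert q ((X ×ˢ V) ∩ gph S) := by
    ext p
    refine ⟨fun hp => hp.2, fun hp => ⟨?_, hp⟩⟩
    rcases hp with rfl | hp
    exacts [hB hq, hp.1]
  refine hmax ⟨fun y => {w | (y, w) ∈ insert q ((X ×ˢ V) ∩ gph S)}, ?_, ?_⟩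
  · intro z₀ h₀ z₁ h₁
    rw [hgph] at h₀ h₁
    rcases h₀ with rfl | h₀ <;> rcases h₁ with rfl | h₁
    · simp
    · rw [← neg_sub z₀.1, ← neg_sub z₀.2, inner_neg_neg]
      exact hrel _ h₁
    · exact hrel _ h₀
    · exact hmono _ h₀ _ h₁
  · rw [hgph]
    exact Set.ssubset_insert hqG

/-- Monotone relatedness survives limits, so maximality makes the graph locally closed. -/
theorem LocallyMaximalMonotone.exists_isCompact [FiniteDimensional ℝ E] {S : E → Set E} {x v : E}
    (h : LocallyMaximalMonotone S x v) :
    ∃ ρ₀ > 0, ∀ ρ ≤ ρ₀, IsCompact (gph S ∩ Metric.closedBall (x, v) ρ) := by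
  have : ProperSpace E := FiniteDimensional.proper ℝ E
  obtain ⟨ρ₀, hρ₀, G, hGS, hG, hmono, hmax⟩ := h.exists_graph_piece
  have hcl : IsClosed (gph S ∩ Metric.closedBall (x, v) ρ₀) := by
    refine isClosed_of_closure_subset fun q hq => ?_
    have hqB : q ∈ Metric.closedBall (x, v) ρ₀ :=
      closure_minimal Set.inter_subset_right Metric.isClosed_closedBall hq
    refine ⟨hGS (hmax q hqB fun p hp => ?_), hqB⟩
    exact closure_minimal (t := {q : E × E | 0 ≤ inner ℝ (q.1 - p.1) (q.2 - p.2)})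
      (fun u hu => hmono p hp u (hG hu)) (isClosed_le continuous_const (by fun_prop)) hq
  refine ⟨ρ₀, hρ₀, fun ρ hρ => ?_⟩
  have : gph S ∩ Metric.closedBall (x, v) ρ =
      Metric.closedBall (x, v) ρ ∩ (gph S ∩ Metric.closedBall (x, v) ρ₀) := by
    ext p
    exact ⟨fun hp => ⟨hp.2, hp.1, Metric.closedBall_subset_closedBall hρ hp.2⟩,
      fun hp => ⟨hp.2.1, hp.1⟩⟩
  rw [this]
  exact (isCompact_closedBall _ _).inter_right hcl

/-- With `d = w - u ≠ 0`, follow `u` to a value `c` at `y + t • d`. Monotonicity against `(y, w)`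
requires `inner ℝ d (c - u) ≥ ‖d‖²`, but `‖c - u‖ ≤ L * t * ‖d‖` with `L * t < 1`. -/
theorem LipschitzLike.exists_unique_near {S : E → Set E} {x v : E}
    (hS : LocallyMaximalMonotone S x v) (h : LipschitzLike S x v) :
    ∃ R > 0, ∀ y u w, (y, u) ∈ gph S ∩ Metric.closedBall (x, v) R →
      (y, w) ∈ gph S ∩ Metric.closedBall (x, v) R → u = w := by
  obtain ⟨ρ₀, hρ₀, G, -, hG, hmono, -⟩ := hS.exists_graph_piece
  obtain ⟨ρ₁, hρ₁, L, hL, h⟩ := h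
  set ρ := min ρ₀ ρ₁ with hρdef
  have hρ : 0 < ρ := lt_min hρ₀ hρ₁
  have hle₀ : ρ ≤ ρ₀ := min_le_left _ _
  have hle₁ : ρ ≤ ρ₁ := min_le_right _ _
  refine ⟨ρ / 2, by positivity, fun y u w ⟨hu, huB⟩ ⟨hw, hwB⟩ => ?_⟩
  by_contra hne
  rw [mem_closedBall_prod_iff] at huB hwB
  simp only at huB hwB
  set d := w - u with hd
  have hdpos : 0 < ‖d‖ := norm_pos_iff.2 (sub_ne_zero.2 (Ne.symm hne))
  obtain ⟨t, ht, ht1, ht2, ht3⟩ : ∃ t > 0, t * ‖d‖ ≤ ρ / 2 ∧ L * (t * ‖d‖) ≤ ρ / 2 ∧ L * t < 1 := by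
    have h1 : ∀ᶠ t in 𝓝[>] (0 : ℝ), t * ‖d‖ < ρ / 2 ∧ L * (t * ‖d‖) < ρ / 2 ∧ L * t < 1 := by
      refine eventually_nhdsWithin_of_eventually_nhds ((Tendsto.eventually_lt_const (v := 0)
        (by positivity) ?_).and ((Tendsto.eventually_lt_const (v := 0) (by positivity) ?_).and
          (Tendsto.eventually_lt_const (v := 0) one_pos ?_))) <;>
      · refine Continuous.tendsto' (by fun_prop) _ _ (by simp)
    obtain ⟨t, ht, ht'⟩ := (h1.and self_mem_nhdsWithin).exists
    exact ⟨t, ht', ht.1.le, ht.2.1.le, ht.2.2⟩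
  have hnt : ‖y + t • d - y‖ = t * ‖d‖ := by
    rw [add_sub_cancel_left, norm_smul, Real.norm_of_nonneg ht.le]
  have hyt : ‖y + t • d - x‖ ≤ ρ := by
    have := norm_sub_le_norm_sub_add_norm_sub (y + t • d) y x
    linarith [huB.1]
  obtain ⟨c, hc, hcu⟩ := h (y, u)
    ⟨hu, mem_closedBall_prod_iff.2 ⟨by simp only; linarith, by simp only; linarith⟩⟩
    (y + t • d) (mem_closedBall_iff_norm.2 (by linarith))
  simp only [hnt] at hcu
  have hcG : (y + t • d, c) ∈ G := hG ⟨hc, mem_closedBall_prod_iff.2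
    ⟨by simp only; linarith, by
      have := norm_sub_le_norm_sub_add_norm_sub c u v
      simp only
      linarith [huB.2]⟩⟩
  have hwG : (y, w) ∈ G := hG ⟨hw, mem_closedBall_prod_iff.2
    ⟨by simp only; linarith, by simp only; linarith⟩⟩
  have h1 := hmono _ hwG _ hcG
  simp only [add_sub_cancel_left, inner_smul_left, RCLike.conj_to_real] at h1
  have h2 : 0 ≤ inner ℝ d (c - w) := nonneg_of_mul_nonneg_right h1 ht
  have e : c - w = (c - u) - d := by rw [hd]; abel
  rw [e, inner_sub_right, real_inner_self_eq_norm_sq] at h2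
  have h3 := real_inner_le_norm d (c - u)
  have h4 : ‖d‖ * ‖c - u‖ ≤ ‖d‖ * (L * (t * ‖d‖)) := by gcongr
  nlinarith [mul_pos hdpos hdpos]

theorem LipschitzLike.hasLipschitzLocalization {S : E → Set E} {x v : E}
    (hS : LocallyMaximalMonotone S x v) (h : LipschitzLike S x v) :
    HasLipschitzLocalization S x v := by
  classical
  obtain ⟨R, hR, huniq⟩ := h.exists_unique_near hS
  have hv : v ∈ S x := hS.1
  obtain ⟨ρ, hρ, L, hL, h⟩ := h
  set r := min R ρ / 2 with hr_def
  have hr : 0 < r := by positivity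
  have hrR : 2 * r ≤ R := by rw [hr_def]; linarith [min_le_left R ρ]
  have hrρ : 2 * r ≤ ρ := by rw [hr_def]; linarith [min_le_right R ρ]
  -- Following `s z` to another argument in the ball moves it by at most `2 * L * δ < r`, hence
  -- stays within `2 * r` of `v`, where values are unique.
  set δ := r / (2 * L + 1) with hδdef
  have hδ : 0 < δ := by positivity
  have hδr : δ * (2 * L + 1) = r := by rw [hδdef]; field_simp
  have hδL : 0 < δ * L := mul_pos hδ hL
  have hex : ∀ y ∈ Metric.closedBall x δ, ∃ w ∈ S y, w ∈ Metric.closedBall v r := fun y hy => by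
    rw [mem_closedBall_iff_norm] at hy
    obtain ⟨w, hw, hwv⟩ := h (x, v) ⟨hv, Metric.mem_closedBall_self hρ.le⟩ y
      (mem_closedBall_iff_norm.2 (by linarith))
    refine ⟨w, hw, mem_closedBall_iff_norm.2 ?_⟩
    have : L * ‖y - x‖ ≤ L * δ := by gcongr
    simp only at hwv
    linarith
  choose! s hsS hsB using hex
  have hloc : ∀ y ∈ Metric.closedBall x δ, ∀ w ∈ S y, ‖w - v‖ ≤ 2 * r → w = s y :=
    fun y hy w hw hwB => by
      have h1 := hsB y hy
      rw [mem_closedBall_iff_norm] at hy h1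
      exact huniq y w (s y)
        ⟨hw, mem_closedBall_prod_iff.2 ⟨by simp only; linarith, by simp only; linarith⟩⟩
        ⟨hsS y (mem_closedBall_iff_norm.2 hy),
          mem_closedBall_prod_iff.2 ⟨by simp only; linarith, by simp only; linarith⟩⟩
  refine ⟨_, Metric.closedBall_mem_nhds x hδ, _, Metric.closedBall_mem_nhds v hr, s, ?_, ?_,
    ⟨L, hL.le⟩, LipschitzOnWith.of_dist_le_mul fun y hy z hz => ?_⟩
  · exact (hloc x (Metric.mem_closedBall_self hδ.le) v hv (by simp [hr.le])).symm
  · ext ⟨y, w⟩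
    constructor
    · rintro ⟨hy, hw⟩
      obtain rfl : w = s y := hw
      exact ⟨⟨hy, hsB y hy⟩, hsS y hy⟩
    · rintro ⟨⟨hy, hwB⟩, hw⟩
      refine ⟨hy, hloc y hy w hw ?_⟩
      rw [mem_closedBall_iff_norm] at hwB
      simp only at hwB
      linarith
  · have hzB := mem_closedBall_iff_norm.1 (hsB z hz)
    have hy' := mem_closedBall_iff_norm.1 hy
    have hz' := mem_closedBall_iff_norm.1 hz
    obtain ⟨w, hw, hwz⟩ := h (z, s z) ⟨hsS z hz, mem_closedBall_prod_iff.2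
      ⟨by simp only; linarith, by simp only; linarith⟩⟩ y (mem_closedBall_iff_norm.2 (by linarith))
    simp only at hwz
    have hyz : ‖y - z‖ ≤ 2 * δ := by
      have := norm_sub_le_norm_sub_add_norm_sub y x z
      rw [norm_sub_rev x z] at this
      linarith
    have h1 : L * ‖y - z‖ ≤ L * (2 * δ) := by gcongr
    have h2 := norm_sub_le_norm_sub_add_norm_sub w (s z) v
    rw [← hloc y hy w hw (by linarith), dist_eq_norm, dist_eq_norm]
    exact hwz

end Monotone

/-! ### The strict derivative and coderivative criteria. -/

section Criteria

section Normed

variable {E F : Type*} [NormedAddCommGroup E] [NormedSpace ℝ E]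
  [NormedAddCommGroup F] [NormedSpace ℝ F]

theorem zero_mem_strictGraphicalDerivative {S : E → Set F} {x : E} {v : F} (hv : v ∈ S x) :
    (0 : F) ∈ strictGraphicalDerivative S x v 0 :=
  ⟨fun _ => (x, v), fun k => 1 / ((k : ℝ) + 1), fun _ => 0, fun _ => hv,
    fun k => by positivity, fun _ => by rwa [smul_zero, add_zero],
    tendsto_const_nhds,
    tendsto_one_div_add_atTop_nhds_zero_nat, tendsto_const_nhds⟩

theorem HasLipschitzLocalization.strictGraphicalDerivative_eq {S : E → Set F} {x : E} {v : F}
    (hv : v ∈ S x) (h : HasLipschitzLocalization S x v) :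
    strictGraphicalDerivative S x v 0 = {0} := by
  refine Set.Subset.antisymm ?_ (Set.singleton_subset_iff.2 (zero_mem_strictGraphicalDerivative hv))
  rintro v' ⟨zs, ts, ws, hz, ht, hzw, hzlim, htlim, hwlim⟩
  obtain ⟨κ, U, hU, hκ⟩ := h.exists_norm_sub_le
  have hzwlim : Tendsto (fun k => zs k + ts k • ws k) atTop (𝓝 (x, v)) := by
    simpa using hzlim.add (htlim.smul hwlim)
  have hev : ∀ᶠ k in atTop, ‖(ws k).2‖ ≤ κ * ‖(ws k).1‖ := by
    filter_upwards [hzlim.eventually_mem hU, hzwlim.eventually_mem hU] with k h1 h2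
    have := hκ _ ⟨hz k, h1⟩ _ ⟨hzw k, h2⟩
    simp only [Prod.fst_add, Prod.snd_add, Prod.smul_fst, Prod.smul_snd, add_sub_cancel_left,
      norm_smul, Real.norm_of_nonneg (ht k).le] at this
    refine le_of_mul_le_mul_left ?_ (ht k)
    linarith
  have hlim := le_of_tendsto_of_tendsto ((continuous_snd.tendsto _).comp hwlim).norm
    ((((continuous_fst.tendsto _).comp hwlim).norm).const_mul (κ : ℝ)) hev
  simpa using hlim

/-- If no constant works, dividing the differences by `‖q.2 - p.2‖` gives, along a subsequence, a
unit vector in the derivative at `0`. -/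
theorem exists_norm_sub_le_of_strictGraphicalDerivative [FiniteDimensional ℝ F]
    {S : E → Set F} {x : E} {v : F} (h : strictGraphicalDerivative S x v 0 ⊆ {0}) :
    ∃ ρ > 0, ∃ κ > 0, ∀ p ∈ gph S ∩ Metric.closedBall (x, v) ρ,
      ∀ q ∈ gph S ∩ Metric.closedBall (x, v) ρ, ‖q.2 - p.2‖ ≤ κ * ‖q.1 - p.1‖ := by
  have : ProperSpace F := FiniteDimensional.proper ℝ F
  by_contra! hcon
  have hpos : ∀ n : ℕ, (0 : ℝ) < 1 / ((n : ℝ) + 1) := fun n => by positivity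
  choose p hp q hq hlt using fun n : ℕ => hcon (1 / ((n : ℝ) + 1)) (hpos n) ((n : ℝ) + 1)
    (by positivity)
  have hto : ∀ r : ℕ → E × F, (∀ n : ℕ, r n ∈ gph S ∩ Metric.closedBall (x, v) (1 / ((n : ℝ) + 1))) →
      Tendsto r atTop (𝓝 (x, v)) := fun r hr =>
    tendsto_iff_dist_tendsto_zero.2 (squeeze_zero (fun _ => dist_nonneg) (fun n => (hr n).2)
      tendsto_one_div_add_atTop_nhds_zero_nat)
  set t : ℕ → ℝ := fun n => ‖(q n).2 - (p n).2‖ with ht_def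
  have ht : ∀ n, 0 < t n := fun n => lt_of_le_of_lt (by positivity) (hlt n)
  have htlim : Tendsto t atTop (𝓝 0) := by
    have h1 := ((continuous_snd.tendsto _).comp (hto q hq)).sub
      ((continuous_snd.tendsto _).comp (hto p hp))
    simpa using h1.norm
  have hsph : ∀ n, (t n)⁻¹ • ((q n).2 - (p n).2) ∈ Metric.sphere (0 : F) 1 := fun n => by
    rw [mem_sphere_zero_iff_norm, norm_smul, norm_inv, Real.norm_of_nonneg (ht n).le]
    exact inv_mul_cancel₀ (ht n).ne'
  obtain ⟨w, hw, φ, hφ, hlim⟩ := (isCompact_sphere (0 : F) 1).tendsto_subseq hsph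
  have hlim1 : Tendsto (fun n => (t n)⁻¹ • ((q n).1 - (p n).1)) atTop (𝓝 0) := by
    refine squeeze_zero_norm (fun n => ?_) tendsto_one_div_add_atTop_nhds_zero_nat
    rw [norm_smul, norm_inv, Real.norm_of_nonneg (ht n).le, inv_mul_le_iff₀ (ht n),
      mul_one_div, le_div_iff₀ (by positivity), mul_comm]
    exact (hlt n).le
  have hmem : w ∈ strictGraphicalDerivative S x v 0 := by
    refine ⟨p ∘ φ, t ∘ φ, fun n => (t (φ n))⁻¹ • (q (φ n) - p (φ n)), fun n => (hp _).1,
      fun n => ht _, fun n => ?_, (hto p hp).comp hφ.tendsto_atTop,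
      htlim.comp hφ.tendsto_atTop, ?_⟩
    · simp only [Function.comp_apply, smul_smul, mul_inv_cancel₀ (ht (φ n)).ne', one_smul,
        add_sub_cancel]
      exact (hq _).1
    · exact (hlim1.comp hφ.tendsto_atTop).prodMk_nhds hlim
  have hw0 : w = 0 := h hmem
  simp [hw0] at hw

end Normed

section Inner

variable {E F : Type*} [NormedAddCommGroup E] [InnerProductSpace ℝ E]
  [NormedAddCommGroup F] [InnerProductSpace ℝ F]

theorem smul_mem_regularNormalCone {C : Set E} {z n : E} (h : n ∈ regularNormalCone C z)
    {t : ℝ} (ht : 0 < t) : t • n ∈ regularNormalCone C z := by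
  refine ⟨h.1, fun ε hε => ?_⟩
  filter_upwards [h.2 (ε / t) (by positivity)] with y hy
  rw [real_inner_smul_left]
  calc t * inner ℝ n (y - z) ≤ t * (ε / t * ‖y - z‖) := by gcongr
    _ = ε * ‖y - z‖ := by field_simp

theorem zero_mem_coderivative {S : E → Set F} {x : E} {v : F} (hv : v ∈ S x) :
    (0 : E) ∈ coderivative S x v 0 := by
  refine ⟨fun _ => WithLp.toLp 2 (x, v), fun _ => 0, fun _ => hv, fun _ => ⟨hv, fun ε hε => ?_⟩,
    tendsto_const_nhds, ?_⟩
  · exact Eventually.of_forall fun y => by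
      rw [inner_zero_left]
      positivity
  · rw [neg_zero]
    exact tendsto_const_nhds

/-- Test the normal along the graph curve over `p.1 + t • a`: `t * ‖a‖² ≤ κ * t * ‖a‖ * ‖b‖ + o(t)`.
-/
theorem HasLipschitzLocalization.eventually_norm_le_of_mem_regularNormalCone
    {S : E → Set F} {x : E} {v : F} (h : HasLipschitzLocalization S x v) :
    ∃ κ : ℝ≥0, ∀ᶠ p in 𝓝 (x, v), ∀ a b,
      WithLp.toLp 2 (a, b) ∈ regularNormalCone (WithLp.ofLp ⁻¹' gph S : Set (WithLp 2 (E × F)))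
        (WithLp.toLp 2 p) → ‖a‖ ≤ κ * ‖b‖ := by
  obtain ⟨X, hX, V, hV, s, -, hgph, κ, hlip⟩ := h
  refine ⟨κ, ?_⟩
  filter_upwards [prod_mem_nhds (interior_mem_nhds.2 hX) hV] with p hp a b hab
  have hpX : X ∈ 𝓝 p.1 := mem_interior_iff_mem_nhds.1 hp.1
  have hps : p = (p.1, s p.1) := Prod.ext rfl
    ((Set.ext_iff.1 hgph p).2 ⟨⟨mem_of_mem_nhds hpX, hp.2⟩, hab.1⟩).2
  rcases eq_or_ne a 0 with rfl | ha
  · simpa using by positivity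
  have hapos : 0 < ‖a‖ := norm_pos_iff.2 ha
  refine le_of_forall_pos_le_add fun ε hε => ?_
  have hline : Tendsto (fun t : ℝ => p.1 + t • a) (𝓝[>] 0) (𝓝 p.1) :=
    (Continuous.tendsto' (by fun_prop) _ _ (by simp)).mono_left nhdsWithin_le_nhds
  have hlineX := hline.eventually_mem hpX
  have hcurve : Tendsto (fun t : ℝ => WithLp.toLp 2 (p.1 + t • a, s (p.1 + t • a)))
      (𝓝[>] 0) (𝓝[WithLp.ofLp ⁻¹' gph S] (WithLp.toLp 2 p)) := by
    refine tendsto_nhdsWithin_iff.2 ⟨?_, ?_⟩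
    · refine ((WithLp.prod_continuous_toLp 2 E F).tendsto p).comp ?_
      rw [hps]
      exact hline.prodMk_nhds ((hlip.continuousOn.continuousAt hpX).tendsto.comp hline)
    · filter_upwards [hlineX] with t ht
      exact ((Set.ext_iff.1 hgph (p.1 + t • a, s (p.1 + t • a))).1 ⟨ht, rfl⟩).2
  have hev := hcurve.eventually (hab.2 (ε / (1 + κ)) (by positivity))
  obtain ⟨t, ⟨ht, htX⟩, ht0⟩ := ((hev.and hlineX).and self_mem_nhdsWithin).exists
  have ht0 : 0 < t := ht0
  have e : WithLp.toLp 2 (p.1 + t • a, s (p.1 + t • a)) - WithLp.toLp 2 p =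
      WithLp.toLp 2 (t • a, s (p.1 + t • a) - s p.1) := by
    rw [← WithLp.toLp_sub]
    congr 1
    nth_rw 3 [hps]
    simp
  rw [e, WithLp.prod_inner_apply] at ht
  simp only [real_inner_smul_right, real_inner_self_eq_norm_sq] at ht
  have hs : ‖s (p.1 + t • a) - s p.1‖ ≤ κ * (t * ‖a‖) := by
    have := hlip.dist_le_mul _ htX _ (mem_of_mem_nhds hpX)
    rwa [dist_eq_norm, dist_eq_norm, add_sub_cancel_left, norm_smul,
      Real.norm_of_nonneg ht0.le] at this
  have h1 := norm_toLp_le_add (t • a) (s (p.1 + t • a) - s p.1)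
  rw [norm_smul, Real.norm_of_nonneg ht0.le] at h1
  have h2 := neg_le_of_abs_le (abs_real_inner_le_norm b (s (p.1 + t • a) - s p.1))
  have h3 : ‖b‖ * ‖s (p.1 + t • a) - s p.1‖ ≤ ‖b‖ * (κ * (t * ‖a‖)) := by gcongr
  have h4 : ε / (1 + κ) * ‖WithLp.toLp 2 (t • a, s (p.1 + t • a) - s p.1)‖ ≤
      ε / (1 + κ) * (t * ‖a‖ + κ * (t * ‖a‖)) := by
    gcongr
    linarith
  have h5 : ε / (1 + κ) * (t * ‖a‖ + κ * (t * ‖a‖)) = ε * (t * ‖a‖) := by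
    field_simp
  have hta : 0 < t * ‖a‖ := mul_pos ht0 hapos
  refine le_of_mul_le_mul_left ?_ hta
  nlinarith

theorem HasLipschitzLocalization.coderivative_eq {S : E → Set F} {x : E} {v : F}
    (hv : v ∈ S x) (h : HasLipschitzLocalization S x v) : coderivative S x v 0 = {0} := by
  refine Set.Subset.antisymm ?_ (Set.singleton_subset_iff.2 (zero_mem_coderivative hv))
  rintro v' ⟨zs, ns, -, hn, hzlim, hnlim⟩
  obtain ⟨κ, hκ⟩ := h.eventually_norm_le_of_mem_regularNormalCone
  have hzlim' : Tendsto (fun k => WithLp.ofLp (zs k)) atTop (𝓝 (x, v)) :=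
    ((WithLp.prod_continuous_ofLp 2 E F).tendsto _).comp hzlim
  have hnlim' : Tendsto (fun k => WithLp.ofLp (ns k)) atTop (𝓝 (v', -0)) :=
    ((WithLp.prod_continuous_ofLp 2 E F).tendsto _).comp hnlim
  have hev : ∀ᶠ k in atTop, ‖(WithLp.ofLp (ns k)).1‖ ≤ κ * ‖(WithLp.ofLp (ns k)).2‖ := by
    filter_upwards [hzlim'.eventually hκ] with k hk
    exact hk _ _ (hn k)
  have hlim := le_of_tendsto_of_tendsto ((continuous_fst.tendsto _).comp hnlim').norm
    ((((continuous_snd.tendsto _).comp hnlim').norm).const_mul (κ : ℝ)) hev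
  simpa using hlim

theorem exists_norm_le_of_coderivative [FiniteDimensional ℝ E]
    {S : E → Set F} {x : E} {v : F} (h : coderivative S x v 0 ⊆ {0}) :
    ∃ ρ > 0, ∃ κ > 0, ∀ p ∈ gph S ∩ Metric.closedBall (x, v) ρ, ∀ a b,
      WithLp.toLp 2 (a, b) ∈ regularNormalCone (WithLp.ofLp ⁻¹' gph S : Set (WithLp 2 (E × F)))
        (WithLp.toLp 2 p) → ‖a‖ ≤ κ * ‖b‖ := by
  have : ProperSpace E := FiniteDimensional.proper ℝ E
  by_contra! hcon
  have hpos : ∀ n : ℕ, (0 : ℝ) < 1 / ((n : ℝ) + 1) := fun n => by positivity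
  choose p hp a b hab hlt using fun n : ℕ => hcon (1 / ((n : ℝ) + 1)) (hpos n) ((n : ℝ) + 1)
    (by positivity)
  have hplim : Tendsto p atTop (𝓝 (x, v)) :=
    tendsto_iff_dist_tendsto_zero.2 (squeeze_zero (fun _ => dist_nonneg) (fun n => (hp n).2)
      tendsto_one_div_add_atTop_nhds_zero_nat)
  have ha : ∀ n, 0 < ‖a n‖ := fun n => lt_of_le_of_lt (by positivity) (hlt n)
  have hsph : ∀ n, ‖a n‖⁻¹ • a n ∈ Metric.sphere (0 : E) 1 := fun n => by
    rw [mem_sphere_zero_iff_norm, norm_smul, norm_inv, norm_norm]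
    exact inv_mul_cancel₀ (ha n).ne'
  obtain ⟨w, hw, φ, hφ, hlim⟩ := (isCompact_sphere (0 : E) 1).tendsto_subseq hsph
  have hlim1 : Tendsto (fun n => ‖a n‖⁻¹ • b n) atTop (𝓝 0) := by
    refine squeeze_zero_norm (fun n => ?_) tendsto_one_div_add_atTop_nhds_zero_nat
    rw [norm_smul, norm_inv, norm_norm, inv_mul_le_iff₀ (ha n),
      mul_one_div, le_div_iff₀ (by positivity), mul_comm]
    exact (hlt n).le
  have hmem : w ∈ coderivative S x v 0 := by
    refine ⟨fun n => WithLp.toLp 2 (p (φ n)),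
      fun n => ‖a (φ n)‖⁻¹ • WithLp.toLp 2 (a (φ n), b (φ n)), fun n => (hp _).1,
      fun n => smul_mem_regularNormalCone (hab _) (inv_pos.2 (ha _)),
      ((WithLp.prod_continuous_toLp 2 E F).tendsto _).comp (hplim.comp hφ.tendsto_atTop), ?_⟩
    rw [neg_zero]
    exact ((WithLp.prod_continuous_toLp 2 E F).tendsto _).comp
      (hlim.prodMk_nhds (hlim1.comp hφ.tendsto_atTop))
  have hw0 : w = 0 := h hmem
  simp [hw0] at hw

/-- First-order optimality for a weighted squared distance on a graph. -/
theorem mem_regularNormalCone_of_eventually_le {S : E → Set F} {q : E × F} (hq : q ∈ gph S)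
    {ε : ℝ} (hε : 0 < ε) (y : E) (c : F)
    (h : ∀ᶠ u in 𝓝[gph S] q,
      ‖q.1 - y‖ ^ 2 + ε * ‖q.2 - c‖ ^ 2 ≤ ‖u.1 - y‖ ^ 2 + ε * ‖u.2 - c‖ ^ 2) :
    WithLp.toLp 2 (y - q.1, ε • (c - q.2)) ∈
      regularNormalCone (WithLp.ofLp ⁻¹' gph S : Set (WithLp 2 (E × F))) (WithLp.toLp 2 q) := by
  refine ⟨hq, fun η hη => ?_⟩
  have hof : Tendsto (fun u : WithLp 2 (E × F) => WithLp.ofLp u)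
      (𝓝[WithLp.ofLp ⁻¹' gph S] (WithLp.toLp 2 q)) (𝓝[gph S] q) :=
    ((WithLp.prod_continuous_ofLp 2 E F).tendsto (WithLp.toLp 2 q)).inf
      (tendsto_principal_principal.2 fun u hu => hu)
  -- Optimality bounds the inner product by `(1 + ε) / 2 * ‖d‖²`, which is at most `η * ‖d‖` at this
  -- radius.
  have hnear : ∀ᶠ u in 𝓝[WithLp.ofLp ⁻¹' gph S] (WithLp.toLp 2 q),
      dist u (WithLp.toLp 2 q) < 2 * η / (1 + ε) :=
    eventually_nhdsWithin_of_eventually_nhds (Metric.ball_mem_nhds _ (by positivity))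
  filter_upwards [hof.eventually h, hnear] with u hu hd
  rw [dist_eq_norm, lt_div_iff₀ (by positivity)] at hd
  have hsq := WithLp.prod_norm_sq_eq_of_L2 (u - WithLp.toLp 2 q)
  set d := u - WithLp.toLp 2 q with hd_def
  have e1 : (WithLp.ofLp u).1 - y = d.fst - (y - q.1) := by
    simp [hd_def]
  have e2 : (WithLp.ofLp u).2 - c = d.snd - (c - q.2) := by
    simp [hd_def]
  rw [e1, e2, norm_sub_rev q.1, norm_sub_rev q.2, norm_sub_sq_real d.fst, norm_sub_sq_real d.snd,
    real_inner_comm _ d.fst, real_inner_comm _ d.snd] at hu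
  have e3 : inner ℝ (WithLp.toLp 2 (y - q.1, ε • (c - q.2))) d =
      inner ℝ (y - q.1) d.fst + ε * inner ℝ (c - q.2) d.snd := by
    rw [WithLp.prod_inner_apply, ← real_inner_smul_left]
    rfl
  rw [e3]
  have h1 : ‖d‖ * (‖d‖ * (1 + ε)) ≤ ‖d‖ * (2 * η) := by gcongr
  nlinarith [sq_nonneg ‖d.fst‖, sq_nonneg ‖d.snd‖, mul_nonneg hε.le (sq_nonneg ‖d.fst‖)]

theorem halvingProperty_of_coderivative [FiniteDimensional ℝ E]
    {S : E → Set F} {x : E} {v : F} {ρ₀ : ℝ} (hρ₀ : 0 < ρ₀)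
    (hK : ∀ ρ ≤ ρ₀, IsCompact (gph S ∩ Metric.closedBall (x, v) ρ))
    (h : coderivative S x v 0 ⊆ {0}) : HalvingProperty S x v := by
  obtain ⟨ρ₁, hρ₁, κ, hκ, h⟩ := exists_norm_le_of_coderivative h
  set ρ := min ρ₀ ρ₁ with hρdef
  have hρ : 0 < ρ := lt_min hρ₀ hρ₁
  set δ := ρ / (4 * κ + 4) with hδdef
  have hδ : 0 < δ := by positivity
  have hδρ : δ * (4 * κ + 4) = ρ := by rw [hδdef]; field_simp
  have hδκ : 0 < δ * κ := mul_pos hδ hκ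
  refine ⟨δ, hδ, 2 * κ, by positivity, fun p ⟨hp, hpB⟩ y hy => ?_⟩
  rw [mem_closedBall_prod_iff] at hpB
  rw [mem_closedBall_iff_norm] at hy
  have hpy : ‖p.1 - y‖ ≤ 2 * δ := by
    have := norm_sub_le_norm_sub_add_norm_sub p.1 x y
    rw [norm_sub_rev x y] at this
    linarith [hpB.1]
  have hpK : p ∈ gph S ∩ Metric.closedBall (x, v) ρ :=
    ⟨hp, mem_closedBall_prod_iff.2 ⟨by linarith [hpB.1], by linarith [hpB.2]⟩⟩
  -- Comparison with `p` gives `‖q.2 - p.2‖ ≤ 2 * κ * ‖p.1 - y‖`, the normal gives `‖q.1 - y‖ ≤ κ *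
  -- ε * ‖q.2 - p.2‖`, and `κ * ε * (2 * κ) = 1 / 2`.
  set ε : ℝ := (1 / (2 * κ)) ^ 2 with hεdef
  have hε : 0 < ε := by positivity
  obtain ⟨q, ⟨hq, hqB⟩, hmin⟩ := (hK ρ (min_le_left _ _)).exists_isMinOn ⟨p, hpK⟩
    (f := fun q => ‖q.1 - y‖ ^ 2 + ε * ‖q.2 - p.2‖ ^ 2) (by fun_prop)
  have hqp : ‖q.1 - y‖ ^ 2 + ε * ‖q.2 - p.2‖ ^ 2 ≤ ‖p.1 - y‖ ^ 2 := by
    simpa using hmin hpK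
  have hq1 : ‖q.1 - y‖ ≤ ‖p.1 - y‖ :=
    (sq_le_sq₀ (norm_nonneg _) (norm_nonneg _)).1 (by nlinarith [sq_nonneg ‖q.2 - p.2‖])
  have hq2' : 1 / (2 * κ) * ‖q.2 - p.2‖ ≤ ‖p.1 - y‖ :=
    (sq_le_sq₀ (by positivity) (norm_nonneg _)).1 (by
      rw [mul_pow]
      nlinarith [sq_nonneg ‖q.1 - y‖])
  have hq2 : ‖q.2 - p.2‖ ≤ 2 * κ * ‖p.1 - y‖ := by
    rwa [one_div, inv_mul_le_iff₀ (by positivity)] at hq2'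
  -- Membership in the open ball makes `q` a local minimizer on the whole graph.
  have hqball : q ∈ Metric.ball (x, v) ρ := by
    rw [← ball_prod_same, Set.mem_prod, mem_ball_iff_norm, mem_ball_iff_norm]
    constructor
    · have := norm_sub_le_norm_sub_add_norm_sub q.1 y x
      linarith
    · have h1 := norm_sub_le_norm_sub_add_norm_sub q.2 p.2 v
      have h2 : 2 * κ * ‖p.1 - y‖ ≤ 2 * κ * (2 * δ) := by gcongr
      linarith [hpB.2]
  have hnormal := mem_regularNormalCone_of_eventually_le hq hε y p.2 (by
    filter_upwards [self_mem_nhdsWithin,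
      mem_nhdsWithin_of_mem_nhds (Metric.isOpen_ball.mem_nhds hqball)] with u hu huB
    exact hmin ⟨hu, Metric.ball_subset_closedBall huB⟩)
  have hle := h q ⟨hq, Metric.closedBall_subset_closedBall (min_le_right _ _) hqB⟩ _ _ hnormal
  rw [norm_smul, Real.norm_of_nonneg hε.le, norm_sub_rev y, norm_sub_rev p.2] at hle
  refine ⟨q, hq, ?_, hq2⟩
  calc ‖q.1 - y‖ ≤ κ * (ε * ‖q.2 - p.2‖) := hle
    _ ≤ κ * (ε * (2 * κ * ‖p.1 - y‖)) := by gcongr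
    _ = 1 / 2 * ‖p.1 - y‖ := by rw [hεdef]; field_simp

theorem halvingProperty_of_strictGraphicalDerivative [FiniteDimensional ℝ E]
    {S : E → Set E} {x v : E} (hS : LocallyMaximalMonotone S x v)
    (h : strictGraphicalDerivative S x v 0 ⊆ {0}) : HalvingProperty S x v := by
  obtain ⟨ρ₁, hρ₁, κ, hκ, h⟩ := exists_norm_sub_le_of_strictGraphicalDerivative h
  obtain ⟨ρ₀, hρ₀, G, hGS, hG, hmono, hmax⟩ := hS.exists_graph_piece
  set ρ := min ρ₀ ρ₁ with hρdef
  have hρ : 0 < ρ := lt_min hρ₀ hρ₁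
  have hle₀ : ρ ≤ ρ₀ := min_le_left _ _
  have hle₁ : ρ ≤ ρ₁ := min_le_right _ _
  set δ := ρ / (4 * κ + 4) with hδdef
  have hδ : 0 < δ := by positivity
  have hδρ : δ * (4 * κ + 4) = ρ := by rw [hδdef]; field_simp
  have hδκ : 0 < δ * κ := mul_pos hδ hκ
  refine ⟨δ, hδ, 2 * κ, by positivity, fun p ⟨hp, hpB⟩ y hy => ?_⟩
  rw [mem_closedBall_prod_iff] at hpB
  rw [mem_closedBall_iff_norm] at hy
  have hpy : ‖p.1 - y‖ ≤ 2 * δ := by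
    have := norm_sub_le_norm_sub_add_norm_sub p.1 x y
    rw [norm_sub_rev x y] at this
    linarith [hpB.1]
  have hpρ : p ∈ Metric.closedBall (x, v) ρ :=
    mem_closedBall_prod_iff.2 ⟨by linarith [hpB.1], by linarith [hpB.2]⟩
  have hpG : p ∈ G := hG ⟨hp, Metric.closedBall_subset_closedBall hle₀ hpρ⟩
  set c : ℝ := 1 / (2 * κ) with hcdef
  have hc : 0 < c := by positivity
  -- A resolvent step: `y - q.1 = c • (q.2 - p.2)`. Monotonicity keeps both `‖q.1 - p.1‖` and `‖y -
  -- q.1‖` below `‖p.1 - y‖`; once `q` is on the graph, `c * κ = 1 / 2` gives the halving.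
  obtain ⟨q, hqz, hq⟩ := exists_add_smul_eq_forall_inner_nonneg hmono hc (y + c • p.2)
  have hstep : c • (q.2 - p.2) = y - q.1 := by
    rw [smul_sub, sub_eq_sub_iff_add_eq_add, add_comm, hqz]
  have hinner : 0 ≤ inner ℝ (q.1 - p.1) (y - q.1) := by
    rw [← hstep, real_inner_smul_right]
    exact mul_nonneg hc.le (hq p hpG)
  have hpyth : ‖p.1 - y‖ ^ 2 =
      ‖q.1 - p.1‖ ^ 2 + 2 * inner ℝ (q.1 - p.1) (y - q.1) + ‖y - q.1‖ ^ 2 := by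
    rw [← norm_add_sq_real, norm_sub_rev]
    congr 2
    abel
  have hqp1 : ‖q.1 - p.1‖ ≤ ‖p.1 - y‖ :=
    (sq_le_sq₀ (norm_nonneg _) (norm_nonneg _)).1 (by nlinarith [sq_nonneg ‖y - q.1‖])
  have hqy : ‖y - q.1‖ ≤ ‖p.1 - y‖ :=
    (sq_le_sq₀ (norm_nonneg _) (norm_nonneg _)).1 (by nlinarith [sq_nonneg ‖q.1 - p.1‖])
  have hnorm : c * ‖q.2 - p.2‖ = ‖y - q.1‖ := by
    rw [← hstep, norm_smul, Real.norm_of_nonneg hc.le]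
  have hq2 : ‖q.2 - p.2‖ ≤ 2 * κ * ‖p.1 - y‖ := by
    have := hnorm.trans_le hqy
    rwa [hcdef, one_div, inv_mul_le_iff₀ (by positivity)] at this
  have hqρ : q ∈ Metric.closedBall (x, v) ρ := by
    refine mem_closedBall_prod_iff.2 ⟨?_, ?_⟩
    · have := norm_sub_le_norm_sub_add_norm_sub q.1 y x
      rw [norm_sub_rev q.1 y] at this
      linarith
    · have h1 := norm_sub_le_norm_sub_add_norm_sub q.2 p.2 v
      have h2 : 2 * κ * ‖p.1 - y‖ ≤ 2 * κ * (2 * δ) := by gcongr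
      linarith [hpB.2]
  have hqS : q ∈ gph S := hGS (hmax q (Metric.closedBall_subset_closedBall hle₀ hqρ) hq)
  have hlip := h p ⟨hp, Metric.closedBall_subset_closedBall hle₁ hpρ⟩ q
    ⟨hqS, Metric.closedBall_subset_closedBall hle₁ hqρ⟩
  refine ⟨q, hqS, ?_, hq2⟩
  rw [norm_sub_rev, ← hnorm]
  calc c * ‖q.2 - p.2‖ ≤ c * (κ * ‖p.1 - y‖) := by gcongr; exact hlip.trans (by gcongr)
    _ = 1 / 2 * ‖p.1 - y‖ := by rw [hcdef]; field_simp

theorem HalvingProperty.hasLipschitzLocalization [FiniteDimensional ℝ E] {S : E → Set E} {x v : E}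
    (hS : LocallyMaximalMonotone S x v) (h : HalvingProperty S x v) :
    HasLipschitzLocalization S x v := by
  obtain ⟨ρ₀, hρ₀, hK⟩ := hS.exists_isCompact
  exact (h.lipschitzLike hρ₀ hK).hasLipschitzLocalization hS

end Inner

end Criteria

end VarAnalysis

theorem theorem2p7 (N : ℕ)
    (S : EuclideanSpace ℝ (Fin N) → Set (EuclideanSpace ℝ (Fin N)))
    (x v : EuclideanSpace ℝ (Fin N))
    (hS : VarAnalysis.LocallyMaximalMonotone S x v) :
    (VarAnalysis.HasAubinProperty S x v ↔ VarAnalysis.HasLipschitzLocalization S x v) ∧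
    (VarAnalysis.HasAubinProperty S x v ↔ VarAnalysis.coderivative S x v 0 = {0}) ∧
    (VarAnalysis.coderivative S x v 0 = {0} ↔
      VarAnalysis.strictGraphicalDerivative S x v 0 = {0}) := by
  have hA : VarAnalysis.HasAubinProperty S x v ↔ VarAnalysis.HasLipschitzLocalization S x v :=
    ⟨fun h => h.lipschitzLike.hasLipschitzLocalization hS, fun h => h.hasAubinProperty⟩
  have hC : VarAnalysis.HasLipschitzLocalization S x v ↔
      VarAnalysis.coderivative S x v 0 = {0} := by
    refine ⟨fun h => h.coderivative_eq hS.1, fun h => ?_⟩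
    obtain ⟨ρ₀, hρ₀, hK⟩ := hS.exists_isCompact
    exact (VarAnalysis.halvingProperty_of_coderivative hρ₀ hK h.subset).hasLipschitzLocalization hS
  have hD : VarAnalysis.HasLipschitzLocalization S x v ↔
      VarAnalysis.strictGraphicalDerivative S x v 0 = {0} :=
    ⟨fun h => h.strictGraphicalDerivative_eq hS.1, fun h =>
      (VarAnalysis.halvingProperty_of_strictGraphicalDerivative hS
        h.subset).hasLipschitzLocalization hS⟩
  exact ⟨hA, hA.trans hC, hC.symm.trans hD⟩
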